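/- For a compact Hausdorff space $X$ let $\mathcal R^{\le 1}(X)$ be the set of Radon subprobability measures on $X$, i.e. Borel measures $\mu$ with $\mu(X)\le 1$ and $\mu(A)=\sup\{\mu(K)\mid K\subseteq A,\ K \text{ compact}\}$ for every Borel set $A$, with the weak-* topology, the coarsest topology making $\mu\mapsto\int_X f\,d\mu$ continuous for every continuous $f:X\to\mathbb R$. A Markov process is a continuous map $\alpha:X\to\mathcal R^{\le 1}(X)$ with $X$ compact Hausdorff. A (coalgebra) morphism from $\alpha:X\to\mathcal R^{\le1}(X)$ to $\beta:Y\to\mathcal R^{\le1}(Y)$ is a continuous map $f:X\to Y$ such that, for every $x\in X$, $\beta(f(x))$ is the push-forward of $\alpha(x)$ along $f$. A final coalgebra is a Markov process to which every Markov process has exactly one morphism. Formulas are generated by $$\phi,\psi ::= 0\mid 1\mid r\phi\mid \phi+\psi\mid\phi\sqcup\psi\mid\phi\sqcap\psi\mid\Diamond\phi\qquad(r\in\mathbb R),$$ and are interpreted in a Markov process $\alpha$ on $X$ as continuous functions $[\![\phi]\!]_\alpha:X\to\mathbb R$: the constants $0$ and $1$, the scalar multiple, the sum, $\sqcup$ and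 $\sqcap$ are interpreted pointwise ($\sqcup$ as maximum, $\sqcap$ as minimum), and $[\![\Diamond\phi]\!]_\alpha(x)=\int_X[\![\phi]\!]_\alpha\,d\alpha(x)$. A final coalgebra $\alpha_{\mathbf F}:\mathbf F\to\mathcal R^{\le1}(\mathbf F)$ exists (it is unique up to isomorphism). Let $\alpha:X\to\mathcal R^{\le 1}(X)$ be a Markov process and $x,y\in X$. Call $x$ and $y$ behaviourally equivalent if $\eta(x)=\eta(y)$, where $\eta:X\to\mathbf F$ is the unique morphism from $\alpha$ to $\alpha_{\mathbf F}$. Then $x$ and $y$ are behaviourally equivalent if and only if $[\![\phi]\!]_\alpha(x)=[\![\phi]\!]_\alpha(y)$ for all formulas $\phi$. -/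

import Mathlib

open MeasureTheory

universe u

namespace RieszModal

/-- Radon subprobability measures on a topological space `X` with its Borel sigma-algebra: Borel
measures of total mass at most one such that the measure of every Borel set is the supremum of the
measures of its compact subsets. -/
structure RadonSubprob (X : Type u) [TopologicalSpace X] [MeasurableSpace X] [BorelSpace X] where
  /-- the underlying Borel measure -/
  toMeasure : Measure X
  mass_le_one : toMeasure Set.univ ≤ 1
  innerRegular : toMeasure.InnerRegularWRT IsCompact MeasurableSet

namespace RadonSubprob

section

variable {X Y : Type u} [TopologicalSpace X] [MeasurableSpace X] [BorelSpace X]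
  [TopologicalSpace Y] [MeasurableSpace Y] [BorelSpace Y]

/-- The expectation functional `f ↦ ∫ f dμ` on continuous functions. -/
noncomputable def expect (μ : RadonSubprob X) (f : C(X, ℝ)) : ℝ := ∫ x, f x ∂μ.toMeasure

/-- The weak-* topology: the coarsest topology for which `μ ↦ ∫ f dμ` is continuous for every
continuous `f : X → ℝ`. -/
noncomputable instance weakStar : TopologicalSpace (RadonSubprob X) :=
  ⨅ f : C(X, ℝ), TopologicalSpace.induced (fun μ : RadonSubprob X => μ.expect f) inferInstance

theorem continuous_expect (f : C(X, ℝ)) : Continuous fun μ : RadonSubprob X => μ.expect f :=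
  continuous_iff_le_induced.2 (iInf_le _ f)

/-- The action of the Radon functor on a continuous map: push-forward of measures. -/
noncomputable def map [T2Space Y] (f : C(X, Y)) (μ : RadonSubprob X) : RadonSubprob Y where
  toMeasure := μ.toMeasure.map f
  mass_le_one := by
    rw [Measure.map_apply f.continuous.measurable MeasurableSet.univ, Set.preimage_univ]
    exact μ.mass_le_one
  innerRegular := by
    intro A hA r hr
    rw [Measure.map_apply f.continuous.measurable hA] at hr
    obtain ⟨K, hKA, hK, hrK⟩ := μ.innerRegular (f.continuous.measurable hA) r hr
    have hfK : IsCompact (f '' K) := hK.image f.continuous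
    refine ⟨f '' K, Set.image_subset_iff.2 hKA, hfK, hrK.trans_le ?_⟩
    rw [Measure.map_apply f.continuous.measurable hfK.measurableSet]
    exact measure_mono (Set.subset_preimage_image f K)

/-- The push-forward acts on expectation functionals by precomposition. -/
theorem expect_map [T2Space Y] (f : C(X, Y)) (μ : RadonSubprob X) (g : C(Y, ℝ)) :
    (μ.map f).expect g = μ.expect (g.comp f) :=
  integral_map f.continuous.measurable.aemeasurable
    g.continuous.measurable.aestronglyMeasurable

end

end RadonSubprob

/-- A Markov process: a compact Hausdorff space `State` (with its Borel sigma-algebra) together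
with a continuous map to the Radon subprobability measures on it, in the weak-* topology. -/
structure MarkovProcess : Type (u + 1) where
  /-- the state space -/
  State : Type u
  [top : TopologicalSpace State]
  [compact : CompactSpace State]
  [hausdorff : T2Space State]
  [meas : MeasurableSpace State]
  [borel : BorelSpace State]
  /-- the transition function -/
  trans : C(State, RadonSubprob State)

attribute [instance] MarkovProcess.top MarkovProcess.compact MarkovProcess.hausdorff
  MarkovProcess.meas MarkovProcess.borel

/-- Formulas of Riesz modal logic. -/
inductive Form : Type
  | zero : Form
  | one : Form
  | smul (r : ℝ) (φ : Form) : Form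
  | add (φ ψ : Form) : Form
  | sup (φ ψ : Form) : Form
  | inf (φ ψ : Form) : Form
  | dia (φ : Form) : Form

namespace MarkovProcess

/-- The operator on continuous functions sending `f` to `x ↦ ∫ f d(α x)`. -/
noncomputable def dia (α : MarkovProcess.{u}) (f : C(α.State, ℝ)) : C(α.State, ℝ) where
  toFun x := (α.trans x).expect f
  continuous_toFun := (RadonSubprob.continuous_expect f).comp α.trans.continuous

/-- The semantics of a formula: a continuous real-valued function on the state space. -/
noncomputable def sem (α : MarkovProcess.{u}) : Form → C(α.State, ℝ)
  | .zero => 0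
  | .one => 1
  | .smul r φ => r • α.sem φ
  | .add φ ψ => α.sem φ + α.sem ψ
  | .sup φ ψ => α.sem φ ⊔ α.sem ψ
  | .inf φ ψ => α.sem φ ⊓ α.sem ψ
  | .dia φ => α.dia (α.sem φ)

/-- Coalgebra morphisms between Markov processes: the commuting square
`β ∘ f = Radon(f) ∘ α`. -/
def IsMorphism (α β : MarkovProcess.{u}) (f : C(α.State, β.State)) : Prop :=
  ∀ x : α.State, β.trans (f x) = (α.trans x).map f

/-- A Markov process is a final coalgebra if every Markov process has exactly one coalgebra
morphism to it. -/
def IsFinal (F : MarkovProcess.{u}) : Prop :=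
  ∀ α : MarkovProcess.{u}, ∃! η : C(α.State, F.State), α.IsMorphism F η

/-- The unique coalgebra morphism to a final coalgebra. -/
noncomputable def IsFinal.behaviour {F : MarkovProcess.{u}} (hF : F.IsFinal)
    (α : MarkovProcess.{u}) : C(α.State, F.State) :=
  (hF α).choose

/-- Two states are behaviourally equivalent if they have the same image in the final coalgebra
`F` under the unique coalgebra morphism. -/
def BehaviourallyEquivalent {F : MarkovProcess.{u}} (hF : F.IsFinal) (α : MarkovProcess.{u})
    (x y : α.State) : Prop :=
  hF.behaviour α x = hF.behaviour α y

end MarkovProcess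

end RieszModal

/-! Morphisms preserve the semantics, so behavioural equivalence implies logical equivalence. For
the converse, a final coalgebra is built out of theories, points of a compact subspace of a product
of intervals. Evaluations at formulas form a Riesz space of continuous functions on it, dense by
Stone-Weierstrass (`dense_range_eval`). For a theory `p`, the assignment `eval φ ↦ p (◇φ)` is well
defined, linear and positive; M. Riesz extension and Riesz-Markov representation turn it into a
Radon subprobability (`exists_measure`). In the resulting process each formula denotes its own
evaluation (`sem_eq_eval`), so sending a state to its theory is the only morphism. The behaviour map
into any final coalgebra then factors through the theory of a state. -/

namespace RieszModal

/-! ### Integration against Radon subprobabilities -/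

namespace RadonSubprob

section

variable {X : Type u} [TopologicalSpace X] [MeasurableSpace X] [BorelSpace X]

instance (μ : RadonSubprob X) : IsFiniteMeasure μ.toMeasure :=
  ⟨μ.mass_le_one.trans_lt ENNReal.one_lt_top⟩

instance (μ : RadonSubprob X) : μ.toMeasure.InnerRegular := ⟨μ.innerRegular⟩

theorem expect_nonneg (μ : RadonSubprob X) {f : C(X, ℝ)} (hf : ∀ x, 0 ≤ f x) :
    0 ≤ μ.expect f :=
  integral_nonneg hf

variable [CompactSpace X]

theorem integrable_continuousMap (μ : RadonSubprob X) (f : C(X, ℝ)) :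
    Integrable f μ.toMeasure :=
  f.continuous.integrable_of_hasCompactSupport (HasCompactSupport.of_compactSpace f)

theorem expect_add (μ : RadonSubprob X) (f g : C(X, ℝ)) :
    μ.expect (f + g) = μ.expect f + μ.expect g :=
  integral_add (μ.integrable_continuousMap f) (μ.integrable_continuousMap g)

theorem expect_sub (μ : RadonSubprob X) (f g : C(X, ℝ)) :
    μ.expect (f - g) = μ.expect f - μ.expect g :=
  integral_sub (μ.integrable_continuousMap f) (μ.integrable_continuousMap g)

omit [CompactSpace X] in
theorem expect_smul (μ : RadonSubprob X) (r : ℝ) (f : C(X, ℝ)) :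
    μ.expect (r • f) = r * μ.expect f :=
  integral_const_mul r f

omit [CompactSpace X] in
theorem abs_expect_le_of_forall_abs_le (μ : RadonSubprob X) {f : C(X, ℝ)} {c : ℝ} (hc : 0 ≤ c)
    (hf : ∀ x, |f x| ≤ c) : |μ.expect f| ≤ c := by
  have h1 : μ.toMeasure.real Set.univ ≤ 1 :=
    ENNReal.toReal_le_of_le_ofReal zero_le_one (by simpa using μ.mass_le_one)
  calc |μ.expect f| ≤ c * μ.toMeasure.real Set.univ :=
        norm_integral_le_of_norm_le_const (f := f) (Filter.Eventually.of_forall hf)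
    _ ≤ c := mul_le_of_le_one_right hc h1

theorem abs_expect_sub_le (μ : RadonSubprob X) (f g : C(X, ℝ)) :
    |μ.expect f - μ.expect g| ≤ dist f g := by
  rw [← expect_sub]
  refine μ.abs_expect_le_of_forall_abs_le dist_nonneg fun x => ?_
  exact ContinuousMap.dist_apply_le_dist (f := f) (g := g) x

theorem continuous_expect_right (μ : RadonSubprob X) : Continuous μ.expect :=
  (LipschitzWith.of_dist_le_mul (K := 1) fun f g => by
    simpa [Real.dist_eq] using μ.abs_expect_sub_le f g).continuous

/-- A map into the Radon subprobability measures is continuous as soon as the expectations of a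
dense set of continuous functions are. -/
theorem continuous_of_dense {Z : Type*} [TopologicalSpace Z] {L : Set C(X, ℝ)} (hL : Dense L)
    {g : Z → RadonSubprob X} (hg : ∀ f ∈ L, Continuous fun z => (g z).expect f) :
    Continuous g := by
  refine continuous_iInf_rng.2 fun f => continuous_induced_rng.2 ?_
  refine continuous_of_uniform_approx_of_continuous fun u hu => ?_
  obtain ⟨ε, hε, hu⟩ := Metric.mem_uniformity_dist.1 hu
  obtain ⟨f', hf', hd⟩ := Metric.dense_iff.1 hL f ε hε
  refine ⟨fun z => (g z).expect f', hg f' hd, fun z => hu ?_⟩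
  rw [Metric.mem_ball, dist_comm] at hf'
  exact ((g z).abs_expect_sub_le f f').trans_lt hf'

variable [T2Space X]

/-- Mass at most one makes the expectation 1-Lipschitz in the sup norm, so agreement on `L` spreads
to all continuous functions, and these determine a Radon measure. -/
theorem ext_of_dense {L : Set C(X, ℝ)} (hL : Dense L) {μ ν : RadonSubprob X}
    (h : ∀ f ∈ L, μ.expect f = ν.expect f) : μ = ν := by
  have heq : μ.expect = ν.expect :=
    Continuous.ext_on hL μ.continuous_expect_right ν.continuous_expect_right h
  have hm : μ.toMeasure = ν.toMeasure :=
    Measure.ext_of_integral_eq_on_compactlySupported fun f => congrFun heq f.toContinuousMap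
  cases μ
  cases ν
  cases hm
  rfl

/-- The Riesz representation theorem for subprobability measures on a compact Hausdorff space. -/
theorem exists_expect_eq (Λ : C(X, ℝ) →ₗ[ℝ] ℝ) (hpos : ∀ f, 0 ≤ f → 0 ≤ Λ f) (hone : Λ 1 ≤ 1) :
    ∃ μ : RadonSubprob X, ∀ f, μ.expect f = Λ f := by
  let Λ' : CompactlySupportedContinuousMap X ℝ →ₚ[ℝ] ℝ := PositiveLinearMap.mk₀
    { toFun := fun f => Λ f.toContinuousMap
      map_add' := fun f g => Λ.map_add f.toContinuousMap g.toContinuousMap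
      map_smul' := fun r f => Λ.map_smul r f.toContinuousMap }
    fun f hf => hpos f.toContinuousMap hf
  have hint : ∀ f : C(X, ℝ), ∫ x, f x ∂(RealRMK.rieszMeasure Λ') = Λ f := fun f =>
    RealRMK.integral_rieszMeasure Λ' ⟨f, HasCompactSupport.of_compactSpace f⟩
  have hmass : RealRMK.rieszMeasure Λ' Set.univ ≤ 1 := by
    have h1 := hint 1
    simp only [ContinuousMap.one_apply, integral_const, smul_eq_mul, mul_one] at h1
    rw [← ENNReal.ofReal_toReal (measure_ne_top (RealRMK.rieszMeasure Λ') Set.univ),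
      ← ENNReal.ofReal_one]
    exact ENNReal.ofReal_le_ofReal (h1.trans_le hone)
  exact ⟨⟨RealRMK.rieszMeasure Λ', hmass, Measure.InnerRegular.innerRegular⟩, hint⟩

end

end RadonSubprob

/-! ### Invariance of the semantics under morphisms -/

namespace MarkovProcess

/-- Only the modality uses the morphism square, through change of variables for the push-forward. -/
theorem sem_comp_of_isMorphism {α β : MarkovProcess.{u}} {f : C(α.State, β.State)}
    (hf : α.IsMorphism β f) (φ : Form) : (β.sem φ).comp f = α.sem φ := by
  induction φ with
  | zero => rfl
  | one => rfl
  | smul r φ ih => rw [sem, sem, ← ih]; rfl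
  | add φ ψ ih₁ ih₂ => rw [sem, sem, ← ih₁, ← ih₂]; rfl
  | sup φ ψ ih₁ ih₂ => rw [sem, sem, ← ih₁, ← ih₂]; rfl
  | inf φ ψ ih₁ ih₂ => rw [sem, sem, ← ih₁, ← ih₂]; rfl
  | dia φ ih =>
    ext x
    change (β.trans (f x)).expect (β.sem φ) = (α.trans x).expect (α.sem φ)
    rw [hf x, RadonSubprob.expect_map, ih]

theorem sem_apply_of_isMorphism {α β : MarkovProcess.{u}} {f : C(α.State, β.State)}
    (hf : α.IsMorphism β f) (φ : Form) (x : α.State) : β.sem φ (f x) = α.sem φ x :=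
  DFunLike.congr_fun (sem_comp_of_isMorphism hf φ) x

theorem IsMorphism.comp {α β γ : MarkovProcess.{u}} {g : C(β.State, γ.State)}
    {f : C(α.State, β.State)} (hg : β.IsMorphism γ g) (hf : α.IsMorphism β f) :
    α.IsMorphism γ (g.comp f) := by
  intro x
  refine RadonSubprob.ext_of_dense dense_univ fun h _ => ?_
  rw [ContinuousMap.comp_apply, hg, hf, RadonSubprob.expect_map, RadonSubprob.expect_map,
    RadonSubprob.expect_map, ContinuousMap.comp_assoc]

end MarkovProcess

/-- The interpretation of a formula is bounded uniformly in all Markov processes. -/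
theorem Form.exists_bound (φ : Form) :
    ∃ c : ℝ, 0 ≤ c ∧ ∀ (α : MarkovProcess.{u}) (x : α.State), |α.sem φ x| ≤ c := by
  induction φ with
  | zero => exact ⟨0, le_rfl, fun α x => by simp [MarkovProcess.sem]⟩
  | one => exact ⟨1, zero_le_one, fun α x => by simp [MarkovProcess.sem]⟩
  | smul r φ ih =>
    obtain ⟨c, hc, h⟩ := ih
    refine ⟨|r| * c, by positivity, fun α x => ?_⟩
    simpa [MarkovProcess.sem, abs_mul] using mul_le_mul_of_nonneg_left (h α x) (abs_nonneg r)
  | add φ ψ ih₁ ih₂ =>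
    obtain ⟨c, hc, h⟩ := ih₁
    obtain ⟨d, hd, k⟩ := ih₂
    exact ⟨c + d, by positivity, fun α x => (abs_add_le _ _).trans (add_le_add (h α x) (k α x))⟩
  | sup φ ψ ih₁ ih₂ =>
    obtain ⟨c, hc, h⟩ := ih₁
    obtain ⟨d, hd, k⟩ := ih₂
    exact ⟨max c d, hc.trans (le_max_left c d), fun α x =>
      abs_max_le_max_abs_abs.trans (max_le_max (h α x) (k α x))⟩
  | inf φ ψ ih₁ ih₂ =>
    obtain ⟨c, hc, h⟩ := ih₁
    obtain ⟨d, hd, k⟩ := ih₂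
    exact ⟨max c d, hc.trans (le_max_left c d), fun α x =>
      abs_min_le_max_abs_abs.trans (max_le_max (h α x) (k α x))⟩
  | dia φ ih =>
    obtain ⟨c, hc, h⟩ := ih
    exact ⟨c, hc, fun α x => (α.trans x).abs_expect_le_of_forall_abs_le hc (h α)⟩

/-- A theory is a valuation of formulas that respects the Riesz space operations and is nonnegative
on formulas that are nonnegative in every Markov process. -/
structure IsTheory (p : Form → ℝ) : Prop where
  one : p .one = 1
  smul (r : ℝ) (φ : Form) : p (.smul r φ) = r * p φ
  add (φ ψ : Form) : p (.add φ ψ) = p φ + p ψ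
  sup (φ ψ : Form) : p (.sup φ ψ) = p φ ⊔ p ψ
  inf (φ ψ : Form) : p (.inf φ ψ) = p φ ⊓ p ψ
  nonneg (φ : Form) (h : ∀ (α : MarkovProcess.{u}) (x : α.State), 0 ≤ α.sem φ x) : 0 ≤ p φ

namespace IsTheory

theorem of_state (α : MarkovProcess.{u}) (x : α.State) :
    IsTheory.{u} fun φ => α.sem φ x where
  one := rfl
  smul _ _ := rfl
  add _ _ := rfl
  sup _ _ := rfl
  inf _ _ := rfl
  nonneg _ h := h α x

variable {p : Form → ℝ} (hp : IsTheory.{u} p)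
include hp

theorem mono {φ ψ : Form}
    (h : ∀ (α : MarkovProcess.{u}) (x : α.State), α.sem φ x ≤ α.sem ψ x) : p φ ≤ p ψ := by
  have := hp.nonneg (.add ψ (.smul (-1) φ)) fun α x => by
    simpa [MarkovProcess.sem] using h α x
  rw [hp.add, hp.smul] at this
  linarith

theorem congr {φ ψ : Form}
    (h : ∀ (α : MarkovProcess.{u}) (x : α.State), α.sem φ x = α.sem ψ x) : p φ = p ψ :=
  le_antisymm (hp.mono fun α x => (h α x).le) (hp.mono fun α x => (h α x).ge)

theorem zero : p .zero = 0 := by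
  rw [hp.congr (ψ := .smul 0 .zero) fun α x => by simp [MarkovProcess.sem], hp.smul, zero_mul]

theorem abs_apply_le {φ : Form} {c : ℝ}
    (h : ∀ (α : MarkovProcess.{u}) (x : α.State), |α.sem φ x| ≤ c) : |p φ| ≤ c := by
  have h1 := hp.mono (φ := φ) (ψ := .smul c .one) fun α x => by
    simpa [MarkovProcess.sem] using (abs_le.1 (h α x)).2
  have h2 := hp.mono (φ := .smul (-c) .one) (ψ := φ) fun α x => by
    simpa [MarkovProcess.sem] using (abs_le.1 (h α x)).1
  rw [hp.smul, hp.one, mul_one] at h1 h2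
  exact abs_le.2 ⟨h2, h1⟩

end IsTheory

/-- The space of all theories, with the topology of pointwise convergence. -/
abbrev TheorySpace : Type u :=
  {p : ULift.{u} Form → ℝ // IsTheory.{u} fun φ => p ⟨φ⟩}

/-! ### The compact space of theories and its evaluations -/

namespace TheorySpace

/-- Each axiom is an equation or weak inequality between finitely many coordinates. The `ULift` on
indices only places the space in universe `u`. -/
theorem isClosed_setOf_isTheory :
    IsClosed {p : ULift.{u} Form → ℝ | IsTheory.{u} fun φ => p ⟨φ⟩} := by
  have hset : {p : ULift.{u} Form → ℝ | IsTheory.{u} fun φ => p ⟨φ⟩} =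
      {p | p ⟨.one⟩ = 1} ∩ (⋂ (r : ℝ) (φ : Form), {p | p ⟨.smul r φ⟩ = r * p ⟨φ⟩}) ∩
      (⋂ (φ : Form) (ψ : Form), {p | p ⟨.add φ ψ⟩ = p ⟨φ⟩ + p ⟨ψ⟩}) ∩
      (⋂ (φ : Form) (ψ : Form), {p | p ⟨.sup φ ψ⟩ = p ⟨φ⟩ ⊔ p ⟨ψ⟩}) ∩
      (⋂ (φ : Form) (ψ : Form), {p | p ⟨.inf φ ψ⟩ = p ⟨φ⟩ ⊓ p ⟨ψ⟩}) ∩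
      (⋂ (φ : Form) (_ : ∀ (α : MarkovProcess.{u}) (x : α.State), 0 ≤ α.sem φ x),
        {p | 0 ≤ p ⟨φ⟩}) := by
    ext p
    simp only [Set.mem_inter_iff, Set.mem_iInter, Set.mem_ofPred_eq]
    exact ⟨fun h => ⟨⟨⟨⟨⟨h.one, h.smul⟩, h.add⟩, h.sup⟩, h.inf⟩, h.nonneg⟩,
      fun ⟨⟨⟨⟨⟨h₁, h₂⟩, h₃⟩, h₄⟩, h₅⟩, h₆⟩ => ⟨h₁, h₂, h₃, h₄, h₅, h₆⟩⟩
  rw [hset]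
  refine ((((IsClosed.inter ?_ ?_).inter ?_).inter ?_).inter ?_).inter ?_
  · exact isClosed_eq (by fun_prop) (by fun_prop)
  · exact isClosed_iInter fun r => isClosed_iInter fun φ => isClosed_eq (by fun_prop) (by fun_prop)
  · exact isClosed_iInter fun φ => isClosed_iInter fun ψ => isClosed_eq (by fun_prop) (by fun_prop)
  · exact isClosed_iInter fun φ => isClosed_iInter fun ψ => isClosed_eq (by fun_prop) (by fun_prop)
  · exact isClosed_iInter fun φ => isClosed_iInter fun ψ => isClosed_eq (by fun_prop) (by fun_prop)
  · exact isClosed_iInter fun φ => isClosed_iInter fun _ => isClosed_le (by fun_prop) (by fun_prop)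

instance : CompactSpace TheorySpace.{u} := by
  -- The bounds do not depend on the process, so they pass to theories and Tychonoff applies to the
  -- box of intervals `[-c φ, c φ]`.
  choose c _ hc using Form.exists_bound.{u}
  refine isCompact_iff_compactSpace.1 (IsCompact.of_isClosed_subset
    (isCompact_univ_pi fun i : ULift.{u} Form => isCompact_Icc (a := -c i.down) (b := c i.down))
    isClosed_setOf_isTheory fun p hp i _ => ?_)
  exact abs_le.1 (hp.abs_apply_le (hc i.down))

instance : MeasurableSpace TheorySpace.{u} := borel _

instance : BorelSpace TheorySpace.{u} := ⟨rfl⟩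

/-- Evaluation of theories at a formula. -/
def eval (φ : Form) : C(TheorySpace.{u}, ℝ) where
  toFun p := p.1 ⟨φ⟩
  continuous_toFun := (continuous_apply _).comp continuous_subtype_val

/-- The theory of a state of a Markov process, depending continuously on the state. -/
noncomputable def ofState (α : MarkovProcess.{u}) : C(α.State, TheorySpace.{u}) where
  toFun x := ⟨fun i : ULift.{u} Form => α.sem i.down x, IsTheory.of_state α x⟩
  continuous_toFun :=
    Continuous.subtype_mk (continuous_pi fun i : ULift.{u} Form => (α.sem i.down).continuous) _

theorem eval_smul (r : ℝ) (φ : Form) : eval.{u} (.smul r φ) = r • eval φ :=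
  ContinuousMap.ext fun p => p.2.smul r φ

theorem eval_add (φ ψ : Form) : eval.{u} (.add φ ψ) = eval φ + eval ψ :=
  ContinuousMap.ext fun p => p.2.add φ ψ

theorem eval_one : eval.{u} .one = 1 :=
  ContinuousMap.ext fun p => p.2.one

theorem eval_zero : eval.{u} .zero = 0 :=
  ContinuousMap.ext fun p => p.2.zero

theorem sem_le_of_eval_le {φ ψ : Form} (h : eval.{u} φ ≤ eval ψ) (α : MarkovProcess.{u})
    (x : α.State) : α.sem φ x ≤ α.sem ψ x :=
  h (ofState α x)

/-- Formulas have no product, so the lattice form of Stone-Weierstrass is used: it suffices to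
interpolate arbitrary values at any two points. -/
theorem dense_range_eval : Dense (Set.range eval.{u}) := by
  refine dense_iff_closure_eq.2 (ContinuousMap.sublattice_closure_eq_top _ ⟨_, .zero, rfl⟩ ?_ ?_ ?_)
  · rintro _ ⟨φ, rfl⟩ _ ⟨ψ, rfl⟩
    exact ⟨.inf φ ψ, ContinuousMap.ext fun p => p.2.inf φ ψ⟩
  · rintro _ ⟨φ, rfl⟩ _ ⟨ψ, rfl⟩
    exact ⟨.sup φ ψ, ContinuousMap.ext fun p => p.2.sup φ ψ⟩
  · intro v p q
    rcases eq_or_ne p q with rfl | hpq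
    · refine ⟨_, ⟨.smul (v p) .one, rfl⟩, ?_, ?_⟩ <;> simp [eval_smul, eval_one]
    · obtain ⟨φ, hφ⟩ : ∃ φ, eval φ p - eval φ q ≠ 0 := by
        by_contra! h
        exact hpq (Subtype.ext (funext fun i => sub_eq_zero.1 (h i.down)))
      -- An affine function of `φ`: the slope fits the difference of the two values, the constant
      -- fits the value at `p`.
      refine ⟨_, ⟨.add (.smul ((v p - v q) / (eval φ p - eval φ q)) φ)
        (.smul (v p - (v p - v q) / (eval φ p - eval φ q) * eval φ p) .one), rfl⟩, ?_, ?_⟩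
      · simp [eval_smul, eval_one, eval_add]
      · simp only [eval_smul, eval_one, eval_add, ContinuousMap.add_apply,
          ContinuousMap.smul_apply, ContinuousMap.one_apply, smul_eq_mul]
        field_simp
        ring

/-- Theories of states are points of the space, so the hypothesis holds in every process and can be
integrated there. Applied in both directions, this makes `diaFunctional` independent of the chosen
formula. -/
theorem apply_dia_mono (p : TheorySpace.{u}) {φ ψ : Form} (h : eval.{u} φ ≤ eval ψ) :
    eval (.dia φ) p ≤ eval (.dia ψ) p := by
  refine p.2.mono fun α x => ?_
  exact integral_mono ((α.trans x).integrable_continuousMap _)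
    ((α.trans x).integrable_continuousMap _) (sem_le_of_eval_le h α)

theorem apply_dia_congr (p : TheorySpace.{u}) {φ ψ : Form} (h : eval.{u} φ = eval ψ) :
    eval (.dia φ) p = eval (.dia ψ) p :=
  le_antisymm (p.apply_dia_mono h.le) (p.apply_dia_mono h.ge)

theorem apply_dia_add (p : TheorySpace.{u}) (φ ψ : Form) :
    eval (.dia (.add φ ψ)) p = eval (.dia φ) p + eval (.dia ψ) p := by
  rw [← ContinuousMap.add_apply, ← eval_add]
  exact p.2.congr fun α x => (α.trans x).expect_add (α.sem φ) (α.sem ψ)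

theorem apply_dia_smul (p : TheorySpace.{u}) (r : ℝ) (φ : Form) :
    eval (.dia (.smul r φ)) p = r * eval (.dia φ) p := by
  rw [← smul_eq_mul, ← ContinuousMap.smul_apply, ← eval_smul]
  exact p.2.congr fun α x => (α.trans x).expect_smul r (α.sem φ)

theorem apply_dia_one_le (p : TheorySpace.{u}) : eval (.dia .one) p ≤ 1 := by
  refine (p.2.mono (ψ := .one) fun α x => ?_).trans_eq p.2.one
  exact (le_abs_self _).trans ((α.trans x).abs_expect_le_of_forall_abs_le zero_le_one
    fun y => by simp [MarkovProcess.sem])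

/-- The subspace of evaluation functions. -/
def evalSubmodule : Submodule ℝ C(TheorySpace.{u}, ℝ) where
  carrier := Set.range eval
  add_mem' := by
    rintro _ _ ⟨φ, rfl⟩ ⟨ψ, rfl⟩
    exact ⟨.add φ ψ, eval_add φ ψ⟩
  zero_mem' := ⟨.zero, eval_zero⟩
  smul_mem' := by
    rintro r _ ⟨φ, rfl⟩
    exact ⟨.smul r φ, eval_smul r φ⟩

/-- The functional sending the evaluation at `φ` to the value of a theory at `◇φ`. -/
noncomputable def diaFunctional (p : TheorySpace.{u}) : C(TheorySpace.{u}, ℝ) →ₗ.[ℝ] ℝ where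
  domain := evalSubmodule
  toFun :=
    { toFun := fun f => eval (.dia f.2.choose) p
      map_add' := fun f g => by
        rw [← apply_dia_add]
        refine p.apply_dia_congr ?_
        rw [eval_add, f.2.choose_spec, g.2.choose_spec, (f + g).2.choose_spec]
        rfl
      map_smul' := fun r f => by
        rw [RingHom.id_apply, smul_eq_mul, ← apply_dia_smul]
        refine p.apply_dia_congr ?_
        rw [eval_smul, f.2.choose_spec, (r • f).2.choose_spec]
        rfl }

theorem diaFunctional_eval (p : TheorySpace.{u}) (φ : Form) :
    p.diaFunctional ⟨eval φ, φ, rfl⟩ = eval (.dia φ) p :=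
  p.apply_dia_congr (Exists.choose_spec (⟨φ, rfl⟩ : ∃ ψ, eval ψ = eval φ))

theorem exists_measure (p : TheorySpace.{u}) :
    ∃ μ : RadonSubprob TheorySpace.{u}, ∀ φ, μ.expect (eval φ) = eval (.dia φ) p := by
  obtain ⟨Λ, hΛ, hpos⟩ := riesz_extension (PointedCone.positive ℝ C(TheorySpace.{u}, ℝ))
    p.diaFunctional
    (by
      rintro ⟨_, φ, rfl⟩ hφ
      rw [diaFunctional_eval]
      refine p.2.nonneg _ fun α x => (α.trans x).expect_nonneg fun y => ?_
      exact hφ (ofState α y))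
    (by
      intro f
      -- Cofinality for the extension theorem: the constant `‖f‖` is an evaluation and dominates
      -- `-f`.
      refine ⟨⟨‖f‖ • 1, .smul ‖f‖ .one, by rw [eval_smul, eval_one]⟩, fun q => ?_⟩
      have h := (abs_le.1 (f.norm_coe_le_norm q)).1
      change 0 ≤ ‖f‖ * 1 + f q
      linarith)
  have hΛe : ∀ φ, Λ (eval φ) = eval (.dia φ) p := fun φ =>
    (hΛ ⟨eval φ, φ, rfl⟩).trans (p.diaFunctional_eval φ)
  obtain ⟨μ, hμ⟩ := RadonSubprob.exists_expect_eq Λ hpos (by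
    rw [← eval_one, hΛe]
    exact p.apply_dia_one_le)
  exact ⟨μ, fun φ => (hμ _).trans (hΛe φ)⟩

end TheorySpace

open TheorySpace

/-- The canonical Markov process on the space of theories. -/
noncomputable def theoryProcess : MarkovProcess.{u} where
  State := TheorySpace.{u}
  trans :=
    { toFun := fun p => p.exists_measure.choose
      -- On evaluations the expectation is the coordinate at `◇φ`, which is continuous in `p`.
      continuous_toFun := RadonSubprob.continuous_of_dense dense_range_eval (by
        rintro _ ⟨φ, rfl⟩
        simp only [fun p : TheorySpace.{u} => p.exists_measure.choose_spec φ]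
        exact (eval (.dia φ)).continuous) }

namespace theoryProcess

theorem expect_trans_eval (p : TheorySpace.{u}) (φ : Form) :
    RadonSubprob.expect (theoryProcess.trans p) (eval φ) = eval (.dia φ) p :=
  p.exists_measure.choose_spec φ

/-- The truth lemma: a theory, viewed as a state, satisfies exactly what it prescribes. -/
theorem sem_eq_eval (φ : Form) : theoryProcess.{u}.sem φ = eval φ := by
  induction φ with
  | zero => exact eval_zero.symm
  | one => exact eval_one.symm
  | smul r φ ih => rw [MarkovProcess.sem, ih]; exact (eval_smul r φ).symm
  | add φ ψ ih₁ ih₂ => rw [MarkovProcess.sem, ih₁, ih₂]; exact (eval_add φ ψ).symm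
  | sup φ ψ ih₁ ih₂ =>
    rw [MarkovProcess.sem, ih₁, ih₂]; exact (ContinuousMap.ext fun p => p.2.sup φ ψ).symm
  | inf φ ψ ih₁ ih₂ =>
    rw [MarkovProcess.sem, ih₁, ih₂]; exact (ContinuousMap.ext fun p => p.2.inf φ ψ).symm
  | dia φ ih => rw [MarkovProcess.sem, ih]; exact ContinuousMap.ext fun p => expect_trans_eval p φ

theorem isMorphism_ofState (α : MarkovProcess.{u}) :
    α.IsMorphism theoryProcess (ofState α) := by
  intro x
  refine RadonSubprob.ext_of_dense dense_range_eval ?_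
  rintro _ ⟨φ, rfl⟩
  refine (expect_trans_eval (ofState α x) φ).trans ?_
  exact (RadonSubprob.expect_map (ofState α) (α.trans x) (eval φ)).symm

/-- Uniqueness: a morphism preserves the semantics, so by the truth lemma every coordinate of `η x`
is forced. -/
theorem isFinal : theoryProcess.{u}.IsFinal := by
  refine fun α => ⟨ofState α, isMorphism_ofState α, fun η hη => ContinuousMap.ext fun x => ?_⟩
  refine Subtype.ext (funext fun i => ?_)
  have h := MarkovProcess.sem_apply_of_isMorphism hη i.down x
  rw [sem_eq_eval] at h
  exact h

end theoryProcess

namespace MarkovProcess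

theorem IsFinal.isMorphism_behaviour {F : MarkovProcess.{u}} (hF : F.IsFinal)
    (α : MarkovProcess.{u}) : α.IsMorphism F (hF.behaviour α) :=
  (hF α).choose_spec.1

theorem IsFinal.eq_behaviour {F : MarkovProcess.{u}} (hF : F.IsFinal) {α : MarkovProcess.{u}}
    {η : C(α.State, F.State)} (hη : α.IsMorphism F η) : η = hF.behaviour α :=
  (hF α).choose_spec.2 η hη

theorem behaviourallyEquivalent_iff {F : MarkovProcess.{u}} (hF : F.IsFinal)
    (α : MarkovProcess.{u}) (x y : α.State) :
    BehaviourallyEquivalent hF α x y ↔ ∀ φ : Form, α.sem φ x = α.sem φ y := by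
  constructor
  · intro h φ
    have hη := hF.isMorphism_behaviour α
    rw [← sem_apply_of_isMorphism hη, ← sem_apply_of_isMorphism hη]
    exact congrArg (F.sem φ) h
  · intro h
    have hxy : ofState α x = ofState α y := Subtype.ext (funext fun i => h i.down)
    -- By uniqueness, the behaviour map of `α` is `ofState α` followed by that of `theoryProcess`,
    -- so equal theories give equal behaviour.
    have hη := hF.eq_behaviour
      ((hF.isMorphism_behaviour theoryProcess).comp (theoryProcess.isMorphism_ofState α))
    rw [BehaviourallyEquivalent, ← hη]
    exact congrArg (hF.behaviour theoryProcess) hxy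

end MarkovProcess

end RieszModal

theorem corollary7p3 :
    (∃ F : RieszModal.MarkovProcess.{u}, F.IsFinal) ∧
      ∀ (F : RieszModal.MarkovProcess.{u}) (hF : F.IsFinal)
        (α : RieszModal.MarkovProcess.{u}) (x y : α.State),
        RieszModal.MarkovProcess.BehaviourallyEquivalent hF α x y ↔
          ∀ φ : RieszModal.Form, α.sem φ x = α.sem φ y :=
  ⟨⟨_, RieszModal.theoryProcess.isFinal⟩, fun _ hF α x y =>
    RieszModal.MarkovProcess.behaviourallyEquivalent_iff hF α x y⟩
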